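/- Let $G$ be a finite non-cyclic group. Let $Cyc(G)=\{y\in G : \langle x,y\rangle \text{ is cyclic for all } x\in G\}$, and let the non-cyclic graph $\Gamma_G$ of $G$ be the simple graph with vertex set $G\setminus Cyc(G)$ in which two vertices $x,y$ are adjacent if and only if the subgroup $\langle x,y\rangle$ is not cyclic. Then $\Gamma_G$ is regular (all its vertices have the same degree) if and only if $G$ is isomorphic to one of the following groups: (1) $Q_8\times\mathbb{Z}_n$, where $n$ is an odd positive integer and $Q_8$ is the quaternion group of order $8$; (2) $P\times\mathbb{Z}_m$, where $P$ is a finite non-cyclic group (not necessarily abelian) of exponent $p$ for some prime $p$, and $m>0$ is an integer such that $\gcd(m,p)=1$. -/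

import Mathlib

universe u

/-- The cyclicizer of an element `x`: all `y` such that `⟨x, y⟩` is cyclic. -/
def elemCyclicizer {G : Type u} [Group G] (x : G) : Set G :=
  {y | IsCyclic (Subgroup.closure ({x, y} : Set G))}

/-- The cyclicizer `Cyc(G)` of a group: the intersection of the cyclicizers of its elements. -/
def groupCyclicizer (G : Type u) [Group G] : Set G :=
  ⋂ x : G, elemCyclicizer x

/-- The non-cyclic graph of `G`: the vertices are the elements of `G` outside `Cyc(G)`, and two
vertices are adjacent iff they generate a subgroup that is not cyclic. -/
def nonCyclicGraph (G : Type u) [Group G] : SimpleGraph {x : G // x ∉ groupCyclicizer G} where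
  Adj x y := ¬ IsCyclic (Subgroup.closure ({(x : G), (y : G)} : Set G))
  symm := ⟨fun x y h => by rwa [Set.pair_comm]⟩
  loopless := ⟨fun x h => h <| by
    rw [Set.pair_eq_singleton, ← Subgroup.zpowers_eq_closure]
    infer_instance⟩

/-- Over a finite group all neighbourhoods are finite, so that degrees make sense. -/
noncomputable instance nonCyclicGraphLocallyFinite (G : Type u) [Group G] [Finite G] :
    (nonCyclicGraph G).LocallyFinite :=
  fun _ => Fintype.ofFinite _

open Subgroup

/-! Write Cyc(x) for `elemCyclicizer x` and C for `groupCyclicizer G`. The degree of x is |G| -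
|Cyc(x)|, so regularity means that |Cyc(x)| is a constant c off C. If ⟨z⟩ is a maximal cyclic
subgroup containing x, then Cyc(z) = ⟨z⟩ ⊆ Cyc(x), and equal sizes force Cyc(x) = ⟨z⟩. So each x
outside C lies in just one maximal cyclic subgroup, of order c.

These subgroups contain C, and their images partition the noncyclic group G/C into cyclic subgroups
of equal order k. Counting conjugacy classes makes k a prime p (`isCyclic_or_prime_of_partition`).
Hence x^p ∈ C for all x, and G is the product of a Sylow p-subgroup P and the p'-part of C
(`exists_sylow_mulEquiv_prod_zmod`). If p ∤ |C|, then P has exponent p. Otherwise D = C ∩ P is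
nontrivial and lies in ⟨x^p⟩ for every x in P outside D, which leaves only Q₈
(`quaternion_of_central_subgroup_eq_zpowers_pow`).

Conversely, in both families every element of the first factor outside its cyclicizer has the
largest order d, so its cyclicizer has size d, and the coprime cyclic factor multiplies this by a
constant. -/

/-- In the cyclic group ⟨z⟩ the equation a^n = 1 has at most n solutions; for n = |v| the subgroup
⟨v⟩ supplies all of them. -/
theorem mem_zpowers_of_orderOf_dvd {G : Type*} [Group G] [Finite G] {z u v : G}
    (hu : u ∈ zpowers z) (hv : v ∈ zpowers z) (h : orderOf u ∣ orderOf v) : u ∈ zpowers v := by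
  classical
  have := Fintype.ofFinite G
  let u' : zpowers z := ⟨u, hu⟩
  let v' : zpowers z := ⟨v, hv⟩
  have hv0 : orderOf v' = orderOf v := orderOf_mk v hv
  have hle : Nat.card (zpowers v') = orderOf v := by rw [Nat.card_zpowers, hv0]
  have hsub : (zpowers v' : Set (zpowers z)).toFinset ⊆
      Finset.univ.filter fun a : zpowers z => a ^ orderOf v = 1 := by
    intro a ha
    rw [Set.mem_toFinset, SetLike.mem_coe] at ha
    rw [Finset.mem_filter]
    exact ⟨Finset.mem_univ _, orderOf_dvd_iff_pow_eq_one.mp (hv0 ▸ orderOf_dvd_of_mem_zpowers ha)⟩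
  have heq := Finset.eq_of_subset_of_card_le hsub (by
    refine (IsCyclic.card_pow_eq_one_le (orderOf_pos v)).trans (le_of_eq ?_)
    rw [← hle, Set.toFinset_card, ← Nat.card_eq_fintype_card]
    rfl)
  have hmem : u' ∈ (zpowers v' : Set (zpowers z)).toFinset := by
    rw [heq, Finset.mem_filter]
    refine ⟨Finset.mem_univ _, Subtype.ext ?_⟩
    exact orderOf_dvd_iff_pow_eq_one.mp h
  rw [Set.mem_toFinset, SetLike.mem_coe, mem_zpowers_iff] at hmem
  obtain ⟨i, hi⟩ := hmem
  exact mem_zpowers_iff.mpr ⟨i, congrArg Subtype.val hi⟩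

theorem zpowers_eq_of_mem_of_orderOf_le {G : Type*} [Group G] [Finite G] {x y : G}
    (h : x ∈ zpowers y) (hle : orderOf y ≤ orderOf x) : zpowers x = zpowers y :=
  eq_of_le_of_card_ge (zpowers_le.mpr h) (by simpa only [Nat.card_zpowers] using hle)

/-! ### Groups partitioned by cyclic subgroups of equal order -/

/-- An element of a cyclically partitioned group that commutes with a generator of a component
of composite order lies in that component. -/
theorem mem_zpowers_of_commute_of_partition {H : Type*} [Group H] [Finite H] {k : ℕ} (hk : 1 < k)
    (hkp : ¬ k.Prime) (hcov : ∀ x : H, ∃ w, orderOf w = k ∧ x ∈ zpowers w)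
    (huniq : ∀ x w w' : H, x ≠ 1 → orderOf w = k → orderOf w' = k → x ∈ zpowers w →
      x ∈ zpowers w' → zpowers w = zpowers w')
    {w y : H} (hw : orderOf w = k) (hc : Commute w y) : y ∈ zpowers w := by
  obtain ⟨v, hv, hyv⟩ := hcov y
  have hyk : orderOf y ∣ k := hv ▸ orderOf_dvd_of_mem_zpowers hyv
  rcases (Nat.le_of_dvd (by omega) hyk).lt_or_eq with hlt | heq
  -- The power (wy)^|y| = w^|y| is nontrivial and lies in the components of both wy and w, so these
  -- coincide.
  · obtain ⟨u, hu, hwyu⟩ := hcov (w * y)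
    have h1 : (w * y) ^ orderOf y = w ^ orderOf y := by
      rw [hc.mul_pow, pow_orderOf_eq_one, mul_one]
    have h2 : w ^ orderOf y ≠ 1 :=
      pow_ne_one_of_lt_orderOf (orderOf_pos y).ne' (by omega)
    have h3 := huniq _ u w h2 hu hw (h1 ▸ pow_mem hwyu _) (pow_mem (mem_zpowers w) _)
    rw [h3] at hwyu
    exact (mul_mem_cancel_left (mem_zpowers w)).mp hwyu
  -- Now y generates a component too. With k = qr, the element w^q y shares the power y^r with y, so
  -- w^q ∈ ⟨y⟩; it is nontrivial because k ≠ q.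
  · obtain ⟨q, hq, hqk⟩ := Nat.exists_prime_and_dvd (show k ≠ 1 by omega)
    have hqlt : q < k := lt_of_le_of_ne (Nat.le_of_dvd (by omega) hqk) fun h => hkp (h ▸ hq)
    obtain ⟨r, rfl⟩ := hqk
    have hr : 0 < r := Nat.pos_of_ne_zero fun h => by subst h; omega
    have hrlt : r < q * r := lt_mul_left hr hq.one_lt
    obtain ⟨u, hu, hwyu⟩ := hcov (w ^ q * y)
    have h1 : (w ^ q * y) ^ r = y ^ r := by
      rw [(hc.pow_left q).mul_pow, ← pow_mul, ← hw, pow_orderOf_eq_one, one_mul]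
    have h2 : y ^ r ≠ 1 := pow_ne_one_of_lt_orderOf hr.ne' (by omega)
    have h3 := huniq _ u y h2 hu heq (h1 ▸ pow_mem hwyu _) (pow_mem (mem_zpowers y) _)
    rw [h3] at hwyu
    have h4 : w ^ q ∈ zpowers y := (mul_mem_cancel_right (mem_zpowers y)).mp hwyu
    have h5 : w ^ q ≠ 1 := pow_ne_one_of_lt_orderOf hq.pos.ne' (by omega)
    rw [huniq _ w y h5 hw heq (pow_mem (mem_zpowers w) _) h4]
    exact mem_zpowers y

/-- The elements of order k form a union of conjugacy classes, each of size |H|/k by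
orbit-stabilizer. -/
theorem card_div_dvd_card_filter_orderOf {H : Type*} [Group H] [Fintype H] {k : ℕ}
    (hs : ∀ w : H, orderOf w = k → Nat.card (centralizer {w}) = k) :
    Nat.card H / k ∣ (Finset.univ.filter fun w : H => orderOf w = k).card := by
  classical
  rw [Finset.card_eq_sum_card_fiberwise (f := ConjClasses.mk)
    (t := (Finset.univ.filter fun w : H => orderOf w = k).image ConjClasses.mk)
    fun w hw => Finset.mem_coe.mpr (Finset.mem_image_of_mem _ hw)]
  refine Finset.dvd_sum fun c hc => ?_
  obtain ⟨w, hw, rfl⟩ := Finset.mem_image.mp hc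
  have hwk : orderOf w = k := (Finset.mem_filter.mp hw).2
  refine dvd_of_eq ?_
  have h1 := ConjClasses.card_carrier w
  have h2 := hs w hwk
  rw [nat_card_centralizer_nat_card_stabilizer, Nat.card_eq_fintype_card] at h2
  rw [h2, ← Nat.card_eq_fintype_card (α := H)] at h1
  rw [← h1, ← Set.toFinset_card]
  congr 1
  ext a
  simp only [Set.mem_toFinset, ConjClasses.mem_carrier_iff_mk_eq, Finset.mem_filter,
    Finset.mem_univ, true_and]
  refine ⟨fun h => ⟨?_, h⟩, fun h => h.2⟩
  obtain ⟨g, hg⟩ := isConj_iff.mp (ConjClasses.mk_eq_mk_iff_isConj.mp h)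
  rw [← hwk, ← hg]
  exact (MulAut.conj g).orderOf_eq a |>.symm

/-- Double count of the pairs (w, x) with |w| = k and 1 ≠ x ∈ ⟨w⟩: each x lies in a single
component, which has φ(k) generators. -/
theorem totient_mul_card_sub_one_of_partition {H : Type*} [Group H] [Fintype H] {k : ℕ}
    (hcov : ∀ x : H, ∃ w, orderOf w = k ∧ x ∈ zpowers w)
    (huniq : ∀ x w w' : H, x ≠ 1 → orderOf w = k → orderOf w' = k → x ∈ zpowers w →
      x ∈ zpowers w' → zpowers w = zpowers w') :
    (Finset.univ.filter fun w : H => orderOf w = k).card * (k - 1) =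
      (Nat.card H - 1) * k.totient := by
  classical
  have hT : (Finset.univ.erase (1 : H)).card = Nat.card H - 1 := by
    rw [Finset.card_erase_of_mem (Finset.mem_univ _), Finset.card_univ, Nat.card_eq_fintype_card]
  rw [← hT]
  refine Finset.card_mul_eq_card_mul (fun w x : H => x ∈ zpowers w) ?_ ?_
  · intro w hw
    have hwk : orderOf w = k := (Finset.mem_filter.mp hw).2
    have : Finset.bipartiteAbove (fun w x : H => x ∈ zpowers w) (Finset.univ.erase (1 : H)) w =
        (zpowers w : Set H).toFinset.erase 1 := by
      ext x
      simp [Finset.mem_bipartiteAbove]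
    rw [this, Finset.card_erase_of_mem (by simp [one_mem]), Set.toFinset_card,
      ← Nat.card_eq_fintype_card, ← hwk, ← Nat.card_zpowers]
    rfl
  · intro x hx
    have hx1 : x ≠ 1 := Finset.ne_of_mem_erase hx
    obtain ⟨w, hw, hxw⟩ := hcov x
    have hcard : Fintype.card (zpowers w) = k := by
      rw [← Nat.card_eq_fintype_card, Nat.card_zpowers, hw]
    rw [← IsCyclic.card_orderOf_eq_totient (α := zpowers w) (d := k) (dvd_of_eq hcard.symm)]
    symm
    refine Finset.card_bij (fun a _ => a.1) ?_ (fun a _ b _ h => Subtype.ext h) ?_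
    · intro a ha
      have hak : orderOf a.1 = k := by
        rw [orderOf_coe]
        exact (Finset.mem_filter.mp ha).2
      rw [Finset.mem_bipartiteBelow, Finset.mem_filter]
      refine ⟨⟨Finset.mem_univ _, hak⟩, ?_⟩
      rwa [zpowers_eq_of_mem_of_orderOf_le a.2 (by omega)]
    · intro w' hw'
      rw [Finset.mem_bipartiteBelow, Finset.mem_filter] at hw'
      have h := huniq x w' w hx1 hw'.1.2 hw hw'.2 hxw
      refine ⟨⟨w', h ▸ mem_zpowers w'⟩, ?_, rfl⟩
      rw [Finset.mem_filter]
      exact ⟨Finset.mem_univ _, by rw [orderOf_mk]; exact hw'.1.2⟩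

/-- A finite group partitioned by cyclic subgroups of equal order `k` is cyclic, or `k` is prime. -/
theorem isCyclic_or_prime_of_partition {H : Type*} [Group H] [Finite H] {k : ℕ} (hk : 1 < k)
    (hcov : ∀ x : H, ∃ w, orderOf w = k ∧ x ∈ zpowers w)
    (huniq : ∀ x w w' : H, x ≠ 1 → orderOf w = k → orderOf w' = k → x ∈ zpowers w →
      x ∈ zpowers w' → zpowers w = zpowers w') : IsCyclic H ∨ k.Prime := by
  by_contra! hcon
  obtain ⟨hcyc, hkp⟩ := hcon
  have := Fintype.ofFinite H
  have hcent : ∀ w : H, orderOf w = k → Nat.card (centralizer {w}) = k := by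
    intro w hw
    have : centralizer {w} = zpowers w := by
      ext y
      rw [mem_centralizer_singleton_iff]
      refine ⟨fun h => mem_zpowers_of_commute_of_partition hk hkp hcov huniq hw h.symm, ?_⟩
      rintro ⟨i, rfl⟩
      exact ((Commute.refl w).zpow_left i).eq
    rw [this, Nat.card_zpowers, hw]
  obtain ⟨r, hr⟩ := card_div_dvd_card_filter_orderOf hcent
  have hcount := totient_mul_card_sub_one_of_partition hcov huniq
  obtain ⟨w, hw, -⟩ := hcov 1
  obtain ⟨s, hs⟩ : k ∣ Nat.card H := hw ▸ orderOf_dvd_natCard w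
  have hs0 : 0 < s := Nat.pos_of_ne_zero fun h => by
    rw [h, mul_zero] at hs
    exact Nat.card_pos.ne' hs
  rw [hr, hs, Nat.mul_div_cancel_left s (by omega)] at hcount
  -- With |H| = ks, the count reads s r (k - 1) = (ks - 1) φ(k), so s divides φ(k).
  have hcop : Nat.Coprime s (k * s - 1) := by
    have h1 : 1 ≤ k * s := Nat.mul_pos (by omega) hs0
    have h2 : Nat.Coprime (k * s) (k * s - 1) := by
      have := (Nat.coprime_self_sub_right h1).mpr (Nat.coprime_one_right (k * s))
      exact this
    exact h2.coprime_dvd_left (Dvd.intro_left k rfl)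
  have hdvd : s ∣ k.totient :=
    hcop.dvd_of_dvd_mul_left (hcount ▸ (Dvd.intro _ (mul_assoc s r (k - 1)).symm))
  obtain ⟨q, hq⟩ := hdvd
  have hφ := Nat.totient_lt k hk
  have hφ0 := Nat.totient_pos.mpr (show 0 < k by omega)
  -- Put k = l + 1, s = m + 1, φ(k) = sq. Then l divides mq, while mq < l because sq < k; hence m =
  -- 0 and |H| = k.
  have hs1 : s = 1 := by
    obtain ⟨l, rfl⟩ : ∃ l, k = l + 1 := ⟨k - 1, by omega⟩
    obtain ⟨m, rfl⟩ : ∃ m, s = m + 1 := ⟨s - 1, by omega⟩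
    have h1 : (l + 1) * (m + 1) - 1 = l * (m + 1) + m := by
      rw [show (l + 1) * (m + 1) = l * (m + 1) + m + 1 by ring, Nat.add_sub_cancel]
    rw [hq, Nat.add_sub_cancel, h1] at hcount
    have h2 : r * l = (l * (m + 1) + m) * q :=
      Nat.eq_of_mul_eq_mul_left hs0 (by linarith)
    have h3 : l ∣ m * q := by
      refine (Nat.dvd_add_right (Dvd.intro ((m + 1) * q) rfl)).mp (Dvd.intro_left r ?_)
      rw [h2]
      ring
    have hq0 : 0 < q := Nat.pos_of_ne_zero fun h => by rw [hq, h] at hφ0; omega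
    have h4 : m * q < l := by nlinarith
    have h5 := Nat.eq_zero_of_dvd_of_lt h3 h4
    rcases Nat.mul_eq_zero.mp h5 with h | h <;> omega
  exact hcyc (isCyclic_of_orderOf_eq_card w (by rw [hw, hs, hs1, mul_one]))

/-! ### Recognizing the quaternion group -/

theorem nonempty_mulEquiv_quaternionGroup_two {P : Type*} [Group P] {x y : P}
    (hx : orderOf x = 4) (hxy : y * x * y⁻¹ = x⁻¹) (hy : y ^ 2 = x ^ 2) (hyx : y ∉ zpowers x)
    (hcov : ∀ g, g ∈ zpowers x ∨ y⁻¹ * g ∈ zpowers x) :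
    Nonempty (P ≃* QuaternionGroup 2) := by
  let e : ZMod (2 * 2) → P := fun i => x ^ i.val
  have hadd : ∀ i j, e (i + j) = e i * e j := fun i j => by
    change x ^ (i + j).val = x ^ i.val * x ^ j.val
    rw [← pow_add, ZMod.val_add, ← pow_mod_orderOf x (i.val + j.val), hx]
  have hsub : ∀ i j, e (j - i) = (e i)⁻¹ * e j := fun i j => by
    rw [eq_inv_mul_iff_mul_eq, ← hadd, add_sub_cancel]
  have htwo : e ((2 : ℕ) : ZMod (2 * 2)) = x ^ 2 := rfl
  have hmem : ∀ i, e i ∈ zpowers x := fun i => pow_mem (mem_zpowers x) _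
  have hinj : ∀ i j, e i = e j → i = j := fun i j h => by
    refine ZMod.val_injective _ (pow_injOn_Iio_orderOf ?_ ?_ h)
    · rw [hx]; exact ZMod.val_lt i
    · rw [hx]; exact ZMod.val_lt j
  have hsurj : ∀ g ∈ zpowers x, ∃ i, e i = g := fun g hg => by
    have hfin : IsOfFinOrder x := orderOf_pos_iff.mp (by omega)
    obtain ⟨m, rfl⟩ := hfin.mem_powers_iff_mem_zpowers.mpr hg
    refine ⟨(m : ZMod (2 * 2)), ?_⟩
    change x ^ (m : ZMod (2 * 2)).val = x ^ m
    rw [ZMod.val_natCast, ← pow_mod_orderOf x m, hx]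
  have hconj : ∀ i, e i * y = y * (e i)⁻¹ := fun i => by
    have h : y * (e i)⁻¹ * y⁻¹ = e i := by
      change y * (x ^ i.val)⁻¹ * y⁻¹ = x ^ i.val
      rw [← conj_inv, ← conj_pow, hxy, inv_pow, inv_inv]
    exact (mul_inv_eq_iff_eq_mul.mp h).symm
  -- Here `y` plays the role of the letter x in the constructor `xa`.
  let f : QuaternionGroup 2 → P
    | .a i => e i
    | .xa i => y * e i
  have hf : ∀ u v, f (u * v) = f u * f v := by
    rintro (i | i) (j | j)
    · exact hadd i j
    · change y * e (j - i) = e i * (y * e j)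
      rw [hsub, ← mul_assoc, ← mul_assoc, hconj]
    · change y * e (i + j) = y * e i * e j
      rw [hadd, mul_assoc]
    · change e (((2 : ℕ) : ZMod (2 * 2)) + j - i) = y * e i * (y * e j)
      rw [add_sub_assoc, hadd, htwo, hsub, ← hy, sq, ← mul_assoc (y * e i) y, mul_assoc y (e i) y,
        hconj]
      simp only [mul_assoc]
  refine ⟨(MulEquiv.ofBijective (MonoidHom.mk' f hf) ⟨?_, ?_⟩).symm⟩
  · rintro (i | i) (j | j) h
    · exact congrArg QuaternionGroup.a (hinj i j h)
    · have h' : e i = y * e j := h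
      exact (hyx ((mul_mem_cancel_right (hmem j)).mp (h' ▸ hmem i))).elim
    · have h' : y * e i = e j := h
      exact (hyx ((mul_mem_cancel_right (hmem i)).mp (h' ▸ hmem j))).elim
    · exact congrArg QuaternionGroup.xa (hinj i j (mul_left_cancel (a := y) h))
  · intro g
    rcases hcov g with h | h
    · obtain ⟨i, hi⟩ := hsurj g h
      exact ⟨.a i, hi⟩
    · obtain ⟨i, hi⟩ := hsurj _ h
      refine ⟨.xa i, ?_⟩
      change y * e i = g
      rw [hi, mul_inv_cancel_left]

theorem mul_pow_of_mul_eq_mul_mul {P : Type*} [Group P] {w y s : P} (hs : s ∈ center P)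
    (h : y * w = w * y * s) (n : ℕ) : (w * y) ^ n = w ^ n * y ^ n * s ^ (n * (n - 1) / 2) := by
  have hc : ∀ (g : P) (i : ℕ), g * s ^ i = s ^ i * g := fun g i =>
    mem_center_iff.mp (pow_mem hs i) g
  have hyw : ∀ n : ℕ, y * w ^ n = w ^ n * y * s ^ n := fun n => by
    induction n with
    | zero => simp
    | succ n ih =>
      rw [pow_succ, ← mul_assoc, ih, mul_assoc, ← hc, ← mul_assoc, mul_assoc (w ^ n) y w, h,
        pow_succ' s]
      simp only [mul_assoc]
  induction n with
  | zero => simp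
  | succ n ih =>
    have hn : (n + 1) * (n + 1 - 1) / 2 = n + n * (n - 1) / 2 := by
      rw [← Finset.sum_range_id_mul_two, ← Finset.sum_range_id_mul_two,
        Nat.mul_div_cancel _ two_pos, Nat.mul_div_cancel _ two_pos, Finset.sum_range_succ, add_comm]
    have h1 : w * y * (w ^ n * y ^ n * s ^ (n * (n - 1) / 2)) =
        w * (y * w ^ n) * y ^ n * s ^ (n * (n - 1) / 2) := by simp only [mul_assoc]
    have h2 : s ^ n * y ^ n = y ^ n * s ^ n := (hc _ _).symm
    rw [pow_succ', ih, hn, h1, hyw, pow_add s, pow_succ' w n, pow_succ' y n]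
    calc w * (w ^ n * y * s ^ n) * y ^ n * s ^ (n * (n - 1) / 2)
        = w * w ^ n * y * (s ^ n * y ^ n) * s ^ (n * (n - 1) / 2) := by simp only [mul_assoc]
      _ = _ := by rw [h2]; simp only [mul_assoc]

theorem exists_commutator_of_pow_prime_mem {P : Type*} [Group P] [Finite P] {p : ℕ}
    (hp : p.Prime) {D : Subgroup P} [D.Normal] (hD : D ≤ center P) (hD0 : D ≠ ⊥)
    (hpow : ∀ x ∉ D, x ^ p ∈ D) (hgen : ∀ x ∉ D, D ≤ zpowers (x ^ p))
    {x y : P} (hxD : x ∉ D) (hx : (x : P ⧸ D) ∈ center (P ⧸ D)) (hy : y ∉ zpowers x) :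
    p = 2 ∧ ∃ w ∈ zpowers x, ∃ s ∈ D, y * w = w * y * s ∧ s ^ 2 = 1 ∧ s ≠ 1 ∧ D ≤ zpowers s := by
  have hDx : ∀ u ∉ D, D ≤ zpowers u := fun u hu =>
    (hgen u hu).trans (zpowers_le.mpr (pow_mem (mem_zpowers u) p))
  have hyD : y ∉ D := fun h => hy (hDx x hxD h)
  -- Since y^p is a power of x^p, some power w of x satisfies w^p y^p = 1; then (wy)^p is a pure
  -- power of the commutator s.
  obtain ⟨j, hj⟩ := mem_zpowers_iff.mp (hgen x hxD (hpow y hyD))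
  set w : P := x ^ (-j) with hw
  have hwx : w ∈ zpowers x := zpow_mem (mem_zpowers x) _
  have hwy : w ^ p * y ^ p = 1 := by
    rw [← hj, hw, ← zpow_natCast, ← zpow_natCast, ← zpow_mul, ← zpow_mul, ← zpow_add,
      ← zpow_zero x]
    congr 1
    ring
  have hwD : (w : P ⧸ D) ∈ center (P ⧸ D) := by
    rw [hw, QuotientGroup.mk_zpow]
    exact zpow_mem hx _
  have hsD : (w * y)⁻¹ * (y * w) ∈ D := by
    rw [← QuotientGroup.eq, QuotientGroup.mk_mul, QuotientGroup.mk_mul]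
    exact (mem_center_iff.mp hwD _).symm
  set s : P := (w * y)⁻¹ * (y * w) with hs
  have hyw : y * w = w * y * s := by rw [hs, mul_inv_cancel_left]
  have hwyD : w * y ∉ D := fun h =>
    hy ((mul_mem_cancel_left hwx).mp (hDx x hxD h))
  have hne : (w * y) ^ p ≠ 1 := fun h => by
    have := hgen _ hwyD
    rw [h, zpowers_one_eq_bot] at this
    exact hD0 (le_bot_iff.mp this)
  have hwp : w ^ p ∈ center P := by
    by_cases h : w ∈ D
    · exact hD (pow_mem h p)
    · exact hD (hpow w h)
  have hsc : s ∈ center P := hD hsD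
  have hsp : s ^ p = 1 := by
    have h1 : y * w * y⁻¹ = s * w := by
      rw [hyw, mul_assoc, mul_assoc, ← mem_center_iff.mp hsc, mul_inv_cancel_left,
        mem_center_iff.mp hsc]
    have h2 : (y * w * y⁻¹) ^ p = w ^ p := by
      rw [conj_pow, mem_center_iff.mp hwp, mul_inv_cancel_right]
    rw [h1, Commute.mul_pow (mem_center_iff.mp hsc w).symm] at h2
    exact mul_eq_right.mp h2
  have hexp := mul_pow_of_mul_eq_mul_mul hsc hyw p
  rw [hwy, one_mul] at hexp
  -- For odd p, p divides p(p - 1)/2, so s^p = 1 would give (wy)^p = 1, although wy ∉ D.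
  have hp2 : p = 2 := by
    refine hp.eq_two_or_odd.resolve_right fun hodd => hne ?_
    obtain ⟨l, hl⟩ : ∃ l, p = 2 * l + 1 := ⟨p / 2, by omega⟩
    have : p * (p - 1) / 2 = p * l := by
      rw [hl, Nat.add_sub_cancel, show (2 * l + 1) * (2 * l) = (2 * l + 1) * l * 2 by ring,
        Nat.mul_div_cancel _ two_pos]
    rw [hexp, this, pow_mul, hsp, one_pow]
  subst hp2
  rw [show 2 * (2 - 1) / 2 = 1 from rfl, pow_one] at hexp
  exact ⟨rfl, w, hwx, s, hsD, hyw, hsp, hexp ▸ hne, hexp ▸ hgen _ hwyD⟩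

/-- A noncyclic `p`-group with a nontrivial proper central subgroup `D` generated by the `p`-th
power of each element outside of `D` is the quaternion group of order `8`. -/
theorem quaternion_of_central_subgroup_eq_zpowers_pow {P : Type*} [Group P] [Finite P] {p : ℕ}
    (hp : p.Prime) (hP : IsPGroup p P) {D : Subgroup P} (hD : D ≤ center P) (hD0 : D ≠ ⊥)
    (hD1 : D ≠ ⊤) (hcyc : ¬ IsCyclic P)
    (hpow : ∀ x ∉ D, x ^ p ∈ D) (hgen : ∀ x ∉ D, D ≤ zpowers (x ^ p)) :
    p = 2 ∧ Nonempty (P ≃* QuaternionGroup 2) := by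
  have : Fact p.Prime := ⟨hp⟩
  have hDn : D.Normal := ⟨fun n hn g => by
    rwa [mem_center_iff.mp (hD hn) g, mul_inv_cancel_right]⟩
  have : Nontrivial (P ⧸ D) := QuotientGroup.nontrivial_iff.mpr hD1
  have : Nontrivial (center (P ⧸ D)) := (hP.to_quotient D).center_nontrivial
  obtain ⟨⟨c, hc⟩, hc1⟩ := exists_ne (1 : center (P ⧸ D))
  obtain ⟨x, rfl⟩ := QuotientGroup.mk_surjective c
  have hxD : x ∉ D := fun h => hc1 (Subtype.ext ((QuotientGroup.eq_one_iff x).mpr h))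
  have key := fun y (hy : y ∉ zpowers x) =>
    exists_commutator_of_pow_prime_mem hp hD hD0 hpow hgen hxD hc hy
  obtain ⟨y, hy⟩ : ∃ y, y ∉ zpowers x := by
    by_contra! h
    exact hcyc ⟨x, h⟩
  obtain ⟨rfl, -, -, s, hsD, -, hs2, hs1, hDs⟩ := key y hy
  have hDeq : ∀ d ∈ D, d = 1 ∨ d = s := fun d hd => by
    obtain ⟨i, rfl⟩ := mem_zpowers_iff.mp (hDs hd)
    rcases Int.even_or_odd' i with ⟨l, rfl | rfl⟩
    · left
      rw [zpow_mul, zpow_ofNat, hs2, one_zpow]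
    · right
      rw [zpow_add, zpow_mul, zpow_ofNat, hs2, one_zpow, one_mul, zpow_one]
  have hsq : ∀ u ∉ D, u ^ 2 = s := fun u hu => by
    refine (hDeq _ (hpow u hu)).resolve_left fun h => ?_
    have := hgen u hu hsD
    rw [h, zpowers_one_eq_bot, mem_bot] at this
    exact hs1 this
  have hxs := hsq x hxD
  have hx4 : x ^ 4 = 1 := by rw [show 4 = 2 * 2 from rfl, pow_mul, hxs, hs2]
  have hDx : D ≤ zpowers x :=
    (hgen x hxD).trans (zpowers_le.mpr (pow_mem (mem_zpowers x) 2))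
  have hinv : ∀ y ∉ zpowers x, y * x * y⁻¹ = x⁻¹ := fun y hy => by
    -- As x is central modulo D, this commutator is 1 or s; the value 1 is excluded because y fails
    -- to commute with some power of x.
    have hmem : y * x * y⁻¹ * x⁻¹ ∈ D := by
      rw [← QuotientGroup.eq_one_iff]
      simp only [QuotientGroup.mk_mul, QuotientGroup.mk_inv]
      rw [mem_center_iff.mp hc, mul_inv_cancel_right, mul_inv_cancel]
    rcases hDeq _ hmem with h | h
    · have hcomm : Commute y x := mul_inv_eq_iff_eq_mul.mp (mul_inv_eq_one.mp h)
      obtain ⟨-, w, hw, t, -, hyw, -, ht, -⟩ := key y hy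
      obtain ⟨i, rfl⟩ := mem_zpowers_iff.mp hw
      rw [(hcomm.zpow_right i).eq] at hyw
      exact (ht (left_eq_mul.mp hyw)).elim
    · rw [mul_inv_eq_iff_eq_mul.mp h, ← hxs, eq_inv_iff_mul_eq_one, ← pow_succ, ← pow_succ, hx4]
  refine ⟨rfl, nonempty_mulEquiv_quaternionGroup_two (x := x) (y := y) ?_ (hinv y hy) ?_ hy ?_⟩
  · exact orderOf_eq_prime_pow (p := 2) (n := 1) (by rw [pow_one, hxs]; exact hs1) hx4
  · rw [hxs, hsq y fun h => hy (hDx h)]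
  · intro g
    -- If g and y⁻¹g both lay outside ⟨x⟩, then g, y and y⁻¹g would all invert x, forcing x² = 1.
    by_contra! hcon
    have h1 := hinv g hcon.1
    have h2 := hinv _ hcon.2
    have h3 : y⁻¹ * x⁻¹ * y = x := by rw [← hinv y hy]; group
    have h4 : y⁻¹ * g * x * (y⁻¹ * g)⁻¹ = y⁻¹ * (g * x * g⁻¹) * y := by group
    rw [h4, h1, h3] at h2
    refine hs1 ?_
    rw [← hxs, sq]
    exact eq_inv_iff_mul_eq_one.mp h2

/-! ### Cyclicizers, maximal cyclic subgroups and degrees -/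

theorem mem_elemCyclicizer_iff {G : Type*} [Group G] {x y : G} :
    y ∈ elemCyclicizer x ↔ ∃ z, x ∈ zpowers z ∧ y ∈ zpowers z := by
  constructor
  · intro h
    obtain ⟨z, hz⟩ := (Subgroup.isCyclic_iff_exists_zpowers_eq_top _).mp
      (show IsCyclic (closure ({x, y} : Set G)) from h)
    refine ⟨z, ?_, ?_⟩ <;> rw [hz] <;> exact subset_closure (by simp)
  · rintro ⟨z, hx, hy⟩
    exact isCyclic_of_le (H' := zpowers z) ((closure_le _).mpr (by
      rintro a (rfl | rfl)
      exacts [hx, hy]))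

theorem mem_groupCyclicizer_iff {G : Type*} [Group G] {y : G} :
    y ∈ groupCyclicizer G ↔ ∀ x, ∃ z, x ∈ zpowers z ∧ y ∈ zpowers z := by
  simp only [groupCyclicizer, Set.mem_iInter, mem_elemCyclicizer_iff]

theorem elemCyclicizer_subset_of_mem_zpowers {G : Type*} [Group G] {x z : G}
    (h : x ∈ zpowers z) : elemCyclicizer z ⊆ elemCyclicizer x := fun y hy => by
  obtain ⟨w, hz, hy⟩ := mem_elemCyclicizer_iff.mp hy
  exact mem_elemCyclicizer_iff.mpr ⟨w, zpowers_le.mpr hz h, hy⟩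

theorem elemCyclicizer_eq_zpowers_of_orderOf_le {G : Type*} [Group G] [Finite G] {z : G}
    (h : ∀ w, z ∈ zpowers w → orderOf w ≤ orderOf z) :
    elemCyclicizer z = zpowers z := by
  ext y
  rw [mem_elemCyclicizer_iff, SetLike.mem_coe]
  refine ⟨?_, fun hy => ⟨z, mem_zpowers z, hy⟩⟩
  rintro ⟨w, hz, hy⟩
  rwa [zpowers_eq_of_mem_of_orderOf_le hz (h w hz)]

/-- Every element of a finite group lies in a maximal cyclic subgroup. -/
theorem exists_mem_zpowers_elemCyclicizer_eq {G : Type*} [Group G] [Finite G] (x : G) :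
    ∃ z, x ∈ zpowers z ∧ elemCyclicizer z = zpowers z := by
  obtain ⟨z, hxz, hz⟩ := Set.exists_max_image {z : G | x ∈ zpowers z} orderOf (Set.toFinite _)
    ⟨x, mem_zpowers x⟩
  exact ⟨z, hxz, elemCyclicizer_eq_zpowers_of_orderOf_le fun w hw =>
    hz w (zpowers_le.mpr hw hxz)⟩

theorem nonCyclicGraph_degree_add_ncard {G : Type u} [Group G] [Finite G]
    (v : {x : G // x ∉ groupCyclicizer G}) :
    (nonCyclicGraph G).degree v + (elemCyclicizer (v : G)).ncard = Nat.card G := by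
  have h : Subtype.val '' ((nonCyclicGraph G).neighborSet v) = (elemCyclicizer (v : G))ᶜ := by
    ext y
    constructor
    · rintro ⟨w, hw, rfl⟩
      exact hw
    · intro hy
      refine ⟨⟨y, fun hC => hy ?_⟩, hy, rfl⟩
      exact mem_elemCyclicizer_iff.mpr (mem_groupCyclicizer_iff.mp hC v)
  rw [← SimpleGraph.card_neighborSet_eq_degree, ← Nat.card_eq_fintype_card,
    Nat.card_coe_set_eq, ← Set.ncard_image_of_injective _ Subtype.val_injective, h, add_comm]
  exact Set.ncard_add_ncard_compl _

theorem nonCyclicGraph_isRegular_iff {G : Type u} [Group G] [Finite G] :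
    (∃ d : ℕ, (nonCyclicGraph G).IsRegularOfDegree d) ↔
      ∃ c : ℕ, ∀ x ∉ groupCyclicizer G, (elemCyclicizer x).ncard = c := by
  constructor
  · rintro ⟨d, hd⟩
    refine ⟨Nat.card G - d, fun x hx => ?_⟩
    have h1 := nonCyclicGraph_degree_add_ncard ⟨x, hx⟩
    rw [hd ⟨x, hx⟩] at h1
    exact (Nat.sub_eq_of_eq_add' h1.symm).symm
  · rintro ⟨c, hc⟩
    refine ⟨Nat.card G - c, fun v => ?_⟩
    have h1 := nonCyclicGraph_degree_add_ncard v
    rw [hc v v.2] at h1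
    omega

/-! ### The listed groups have regular graphs -/

theorem prodMk_mem_zpowers_of_coprime {A B : Type*} [Group A] [Group B] {c a : A} {g b : B}
    (hcop : (orderOf c).Coprime (orderOf g)) (ha : a ∈ zpowers c) (hb : b ∈ zpowers g) :
    (a, b) ∈ zpowers (c, g) := by
  obtain ⟨i, rfl⟩ := mem_zpowers_iff.mp ha
  obtain ⟨j, rfl⟩ := mem_zpowers_iff.mp hb
  obtain ⟨r, s, hrs⟩ := Nat.isCoprime_iff_coprime.mpr hcop
  refine mem_zpowers_iff.mpr ⟨i * (s * orderOf g) + j * (r * orderOf c), ?_⟩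
  have hc : ∀ l : ℤ, c ^ (l * orderOf c) = 1 := fun l => by
    rw [mul_comm, zpow_mul, zpow_natCast, pow_orderOf_eq_one, one_zpow]
  have hg : ∀ l : ℤ, g ^ (l * orderOf g) = 1 := fun l => by
    rw [mul_comm, zpow_mul, zpow_natCast, pow_orderOf_eq_one, one_zpow]
  refine Prod.ext ?_ ?_
  · rw [Prod.pow_fst,
      show i * (s * (orderOf g : ℤ)) + j * (r * orderOf c) =
      i + (j * r - i * r) * orderOf c by linear_combination i * hrs, zpow_add, hc, mul_one]
  · rw [Prod.pow_snd,
      show i * (s * (orderOf g : ℤ)) + j * (r * orderOf c) =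
      j + (i * s - j * s) * orderOf g by linear_combination j * hrs, zpow_add, hg, mul_one]

theorem elemCyclicizer_prod_of_coprime {A B : Type*} [Group A] [Group B] {t : B}
    (ht : ∀ b, b ∈ zpowers t) (hcop : ∀ c : A, (orderOf c).Coprime (orderOf t)) (x : A × B) :
    elemCyclicizer x = elemCyclicizer x.1 ×ˢ Set.univ := by
  ext y
  simp only [Set.mem_prod, Set.mem_univ, and_true, mem_elemCyclicizer_iff]
  constructor
  · rintro ⟨z, hx, hy⟩
    obtain ⟨i, rfl⟩ := mem_zpowers_iff.mp hx
    obtain ⟨j, rfl⟩ := mem_zpowers_iff.mp hy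
    exact ⟨z.1, mem_zpowers_iff.mpr ⟨i, rfl⟩, mem_zpowers_iff.mpr ⟨j, rfl⟩⟩
  · rintro ⟨z, hx, hy⟩
    exact ⟨(z, t), prodMk_mem_zpowers_of_coprime (hcop z) hx (ht _),
      prodMk_mem_zpowers_of_coprime (hcop z) hy (ht _)⟩

theorem elemCyclicizer_map {G H : Type*} [Group G] [Group H] (e : G ≃* H) (x : G) :
    elemCyclicizer (e x) = e '' elemCyclicizer x := by
  have key : ∀ {u z : G}, u ∈ zpowers z → e u ∈ zpowers (e z) := fun {u z} h => by
    rw [← MulEquiv.coe_toMonoidHom, ← MonoidHom.map_zpowers]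
    exact mem_map_of_mem _ h
  have key' : ∀ {u z : H}, u ∈ zpowers z → e.symm u ∈ zpowers (e.symm z) := fun {u z} h => by
    rw [← MulEquiv.coe_toMonoidHom, ← MonoidHom.map_zpowers]
    exact mem_map_of_mem _ h
  ext y
  rw [Set.mem_image, mem_elemCyclicizer_iff]
  constructor
  · rintro ⟨z, hx, hy⟩
    refine ⟨e.symm y, mem_elemCyclicizer_iff.mpr ⟨e.symm z, ?_, key' hy⟩, e.apply_symm_apply y⟩
    simpa using key' hx
  · rintro ⟨y, hy, rfl⟩
    obtain ⟨z, hx, hy⟩ := mem_elemCyclicizer_iff.mp hy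
    exact ⟨e z, key hx, key hy⟩

/-- If `A` is a finite group in which all elements outside of the cyclicizer have the same order,
which is the largest order of an element, then its products with cyclic groups of coprime order
have regular noncyclic graphs. -/
theorem ncard_elemCyclicizer_of_mulEquiv_prod {G A : Type*} [Group G] [Group A] [Finite A]
    {d m : ℕ} (hd : ∀ a : A, orderOf a ≤ d) (hC : ∀ a ∉ groupCyclicizer A, orderOf a = d)
    (hcop : ∀ a : A, (orderOf a).Coprime m) (e : G ≃* A × Multiplicative (ZMod m))
    {x : G} (hx : x ∉ groupCyclicizer G) : (elemCyclicizer x).ncard = d * m := by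
  obtain ⟨t, ht⟩ := IsCyclic.exists_generator (α := Multiplicative (ZMod m))
  -- For m = 0 this still holds: `ZMod 0` is infinite and `Nat.card` gives 0.
  have hcard : Nat.card (Multiplicative (ZMod m)) = m := Nat.card_zmod m
  have htm : orderOf t = m := by rw [orderOf_eq_card_of_forall_mem_zpowers ht, hcard]
  have hprod := elemCyclicizer_prod_of_coprime (A := A) ht (by rwa [htm])
  have hmap : ∀ x : G, e '' elemCyclicizer x = elemCyclicizer (e x).1 ×ˢ Set.univ := fun x => by
    rw [← elemCyclicizer_map, hprod]
  have hx1 : (e x).1 ∉ groupCyclicizer A := by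
    refine fun h => hx (Set.mem_iInter.mpr fun g => ?_)
    rw [← e.injective.mem_set_image, hmap]
    exact ⟨Set.mem_iInter.mp h _, Set.mem_univ _⟩
  have hxd := hC _ hx1
  rw [← Set.ncard_image_of_injective _ e.injective, hmap, Set.ncard_prod, Set.ncard_univ, hcard,
    elemCyclicizer_eq_zpowers_of_orderOf_le fun w _ => hxd ▸ hd w, ← hxd, ← Nat.card_zpowers]
  rfl

theorem ncard_elemCyclicizer_of_mulEquiv_quaternion_prod {G : Type*} [Group G] {n : ℕ}
    (hn : Odd n) (e : G ≃* QuaternionGroup 2 × Multiplicative (ZMod n)) {x : G}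
    (hx : x ∉ groupCyclicizer G) : (elemCyclicizer x).ncard = 4 * n := by
  have h4 : ∀ a : QuaternionGroup 2, a ^ 4 = 1 := by decide
  have hdvd : ∀ a : QuaternionGroup 2, orderOf a ∣ 4 := fun a => orderOf_dvd_of_pow_eq_one (h4 a)
  refine ncard_elemCyclicizer_of_mulEquiv_prod (fun a => Nat.le_of_dvd (by norm_num) (hdvd a))
    (fun a ha => ?_) (fun a => ?_) e hx
  · refine orderOf_eq_prime_pow (p := 2) (n := 1) (fun h2 => ha ?_) (h4 a)
    have key : ∀ a : QuaternionGroup 2, a ^ (2 ^ 1) = 1 → ∀ b : QuaternionGroup 2,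
        a = 1 ∨ b = 1 ∨ a = b ∨ a = b ^ 2 := by decide
    refine mem_groupCyclicizer_iff.mpr fun b => ?_
    rcases key a h2 b with rfl | rfl | rfl | rfl
    · exact ⟨b, mem_zpowers b, one_mem _⟩
    · exact ⟨a, one_mem _, mem_zpowers a⟩
    · exact ⟨a, mem_zpowers a, mem_zpowers a⟩
    · exact ⟨b, mem_zpowers b, pow_mem (mem_zpowers b) 2⟩
  · refine Nat.Coprime.coprime_dvd_left (hdvd a) ?_
    exact Nat.Coprime.pow_left 2 (Nat.coprime_two_left.mpr hn)

theorem ncard_elemCyclicizer_of_mulEquiv_exponent_prod {G P : Type*} [Group G] [Group P] [Finite P]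
    {p m : ℕ} (hp : p.Prime) (hexp : Monoid.exponent P = p) (hm : Nat.gcd m p = 1)
    (e : G ≃* P × Multiplicative (ZMod m)) {x : G} (hx : x ∉ groupCyclicizer G) :
    (elemCyclicizer x).ncard = p * m := by
  have hdvd : ∀ a : P, orderOf a ∣ p := fun a => hexp ▸ Monoid.order_dvd_exponent a
  refine ncard_elemCyclicizer_of_mulEquiv_prod (fun a => Nat.le_of_dvd hp.pos (hdvd a))
    (fun a ha => ?_) (fun a => ?_) e hx
  · refine ((Nat.dvd_prime hp).mp (hdvd a)).resolve_left fun h => ha ?_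
    rw [orderOf_eq_one_iff.mp h]
    exact mem_groupCyclicizer_iff.mpr fun b => ⟨b, mem_zpowers b, one_mem _⟩
  · exact Nat.Coprime.coprime_dvd_left (hdvd a) (Nat.coprime_comm.mp hm)

/-! ### The cyclicizer subgroup and the partition of its quotient -/

/-- The cyclicizer of a group, as a subgroup. -/
def cyclicizerSubgroup (G : Type*) [Group G] : Subgroup G where
  carrier := groupCyclicizer G
  one_mem' := mem_groupCyclicizer_iff.mpr fun x => ⟨x, mem_zpowers x, one_mem _⟩
  mul_mem' := by
    intro a b ha hb
    refine mem_groupCyclicizer_iff.mpr fun x => ?_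
    obtain ⟨z, hx, ha⟩ := mem_groupCyclicizer_iff.mp ha x
    obtain ⟨w, hz, hb⟩ := mem_groupCyclicizer_iff.mp hb z
    have hzw := zpowers_le.mpr hz
    exact ⟨w, hzw hx, mul_mem (hzw ha) hb⟩
  inv_mem' := by
    intro a ha
    refine mem_groupCyclicizer_iff.mpr fun x => ?_
    obtain ⟨z, hx, ha⟩ := mem_groupCyclicizer_iff.mp ha x
    exact ⟨z, hx, inv_mem ha⟩

theorem cyclicizerSubgroup_le_center (G : Type*) [Group G] :
    cyclicizerSubgroup G ≤ center G := fun y hy => mem_center_iff.mpr fun g => by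
  obtain ⟨z, hg, hy⟩ := mem_groupCyclicizer_iff.mp hy g
  obtain ⟨i, rfl⟩ := mem_zpowers_iff.mp hg
  obtain ⟨j, rfl⟩ := mem_zpowers_iff.mp hy
  rw [← zpow_add, ← zpow_add, add_comm]

instance cyclicizerSubgroup_normal (G : Type*) [Group G] : (cyclicizerSubgroup G).Normal :=
  ⟨fun n hn g => by
    rwa [mem_center_iff.mp (cyclicizerSubgroup_le_center G hn) g, mul_inv_cancel_right]⟩

theorem cyclicizerSubgroup_le_zpowers {G : Type*} [Group G] {z : G}
    (hz : elemCyclicizer z = zpowers z) : cyclicizerSubgroup G ≤ zpowers z := fun y hy => by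
  rw [← SetLike.mem_coe, ← hz]
  exact Set.mem_iInter.mp hy z

theorem exists_zpowers_of_cyclicizerSubgroup {G : Type*} [Group G] [Finite G] (x : G) :
    ∃ z, x ∈ zpowers z ∧ cyclicizerSubgroup G ≤ zpowers z := by
  obtain ⟨z, hx, hz⟩ := exists_mem_zpowers_elemCyclicizer_eq x
  exact ⟨z, hx, cyclicizerSubgroup_le_zpowers hz⟩

theorem exists_elemCyclicizer_eq_zpowers_of_ncard_eq {G : Type*} [Group G] [Finite G] {c : ℕ}
    (hc : ∀ x ∉ groupCyclicizer G, (elemCyclicizer x).ncard = c) {x : G}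
    (hx : x ∉ cyclicizerSubgroup G) :
    ∃ z, orderOf z = c ∧ x ∈ zpowers z ∧ elemCyclicizer x = zpowers z ∧
      cyclicizerSubgroup G ≤ zpowers z := by
  obtain ⟨z, hxz, hz⟩ := exists_mem_zpowers_elemCyclicizer_eq x
  have hzC : z ∉ cyclicizerSubgroup G := fun h => hx (zpowers_le.mpr h hxz)
  have heq := Set.eq_of_subset_of_ncard_le (elemCyclicizer_subset_of_mem_zpowers hxz)
    (by rw [hc x hx, hc z hzC])
  refine ⟨z, ?_, hxz, heq ▸ hz, cyclicizerSubgroup_le_zpowers hz⟩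
  rw [← hc z hzC, hz, ← Nat.card_zpowers]
  rfl

/-- Multiplicativity of the index along ⊥ ≤ N ≤ ⟨z⟩. -/
theorem orderOf_mk_mul_card_of_le_zpowers {G : Type*} [Group G] {N : Subgroup G} [N.Normal]
    {z : G} (h : N ≤ zpowers z) : orderOf (z : G ⧸ N) * Nat.card N = orderOf z := by
  have h1 := relIndex_ker (zpowers z) (QuotientGroup.mk' N)
  rw [QuotientGroup.ker_mk', MonoidHom.map_zpowers, Nat.card_zpowers] at h1
  have h2 := relIndex_mul_relIndex ⊥ N (zpowers z) bot_le h
  rw [relIndex_bot_left, relIndex_bot_left, Nat.card_zpowers, h1, mul_comm] at h2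
  exact h2

theorem cyclicizerSubgroup_ne_top {G : Type*} [Group G] [Finite G] (hG : ¬ IsCyclic G) :
    cyclicizerSubgroup G ≠ ⊤ := fun h => by
  obtain ⟨z, -, hz⟩ := exists_zpowers_of_cyclicizerSubgroup (1 : G)
  exact hG ⟨z, fun x => hz (h ▸ mem_top x)⟩

theorem not_isCyclic_quotient_cyclicizerSubgroup {G : Type*} [Group G] [Finite G]
    (hG : ¬ IsCyclic G) : ¬ IsCyclic (G ⧸ cyclicizerSubgroup G) := by
  rintro ⟨g, hg⟩
  obtain ⟨x, rfl⟩ := QuotientGroup.mk_surjective g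
  obtain ⟨z, hxz, hz⟩ := exists_zpowers_of_cyclicizerSubgroup x
  refine hG ⟨z, fun y => ?_⟩
  obtain ⟨i, hi⟩ := mem_zpowers_iff.mp (hg y)
  rw [← QuotientGroup.mk_zpow, QuotientGroup.eq] at hi
  exact (mul_mem_cancel_left (inv_mem (zpow_mem hxz i))).mp (hz hi)

theorem exists_prime_forall_pow_mem_cyclicizerSubgroup {G : Type*} [Group G] [Finite G]
    (hG : ¬ IsCyclic G) {c : ℕ} (hc : ∀ x ∉ groupCyclicizer G, (elemCyclicizer x).ncard = c) :
    ∃ p : ℕ, p.Prime ∧ ∀ x : G, x ^ p ∈ cyclicizerSubgroup G := by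
  set C := cyclicizerSubgroup G
  have hmax := fun {x : G} (hx : x ∉ C) => exists_elemCyclicizer_eq_zpowers_of_ncard_eq hc hx
  have hCpos : 0 < Nat.card C := Nat.card_pos
  obtain ⟨x₀, hx₀⟩ : ∃ x, x ∉ C := by
    by_contra! h
    exact cyclicizerSubgroup_ne_top hG ((eq_top_iff' _).mpr h)
  obtain ⟨z₀, hz₀, hxz₀, -, hCz₀⟩ := hmax hx₀
  obtain ⟨k, hk⟩ : ∃ k, orderOf (z₀ : G ⧸ C) = k := ⟨_, rfl⟩
  have hkc : k * Nat.card C = c := by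
    rw [← hz₀, ← orderOf_mk_mul_card_of_le_zpowers hCz₀, hk]
  have hord : ∀ z : G, orderOf z = c → C ≤ zpowers z → orderOf (z : G ⧸ C) = k := by
    intro z hz hCz
    refine Nat.eq_of_mul_eq_mul_right hCpos ?_
    rw [orderOf_mk_mul_card_of_le_zpowers hCz, hz, hkc]
  have hmem : ∀ {x y : G}, (x : G ⧸ C) ∈ zpowers (y : G ⧸ C) → ∀ {z}, C ≤ zpowers z →
      y ∈ zpowers z → x ∈ zpowers z := by
    intro x y hxy z hCz hyz
    obtain ⟨i, hi⟩ := mem_zpowers_iff.mp hxy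
    rw [← QuotientGroup.mk_zpow, QuotientGroup.eq] at hi
    exact (mul_mem_cancel_left (inv_mem (zpow_mem hyz i))).mp (hCz hi)
  have hmap : ∀ {x z : G}, x ∈ zpowers z → (x : G ⧸ C) ∈ zpowers (z : G ⧸ C) := by
    rintro x z ⟨i, rfl⟩
    exact ⟨i, rfl⟩
  have hcov : ∀ g : G ⧸ C, ∃ w, orderOf w = k ∧ g ∈ zpowers w := by
    intro g
    obtain ⟨x, rfl⟩ := QuotientGroup.mk_surjective g
    by_cases hx : x ∈ C
    · exact ⟨z₀, hk, by rw [(QuotientGroup.eq_one_iff x).mpr hx]; exact one_mem _⟩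
    · obtain ⟨z, hz, hxz, -, hCz⟩ := hmax hx
      exact ⟨z, hord z hz hCz, hmap hxz⟩
  have hk1 : 1 < k := by
    have hz₀C : z₀ ∉ C := fun h => hx₀ (zpowers_le.mpr h hxz₀)
    have h0 : 0 < k := hk ▸ orderOf_pos _
    have h1 : k ≠ 1 := fun h =>
      hz₀C ((QuotientGroup.eq_one_iff z₀).mp (orderOf_eq_one_iff.mp (hk.trans h)))
    omega
  have huniq : ∀ g w w' : G ⧸ C, g ≠ 1 → orderOf w = k → orderOf w' = k → g ∈ zpowers w →
      g ∈ zpowers w' → zpowers w = zpowers w' := by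
    -- A component through the class of x is the image of Cyc(x), hence determined by x: a lift of
    -- its generator lies in some ⟨z⟩ of order c, whose image has order k and so is the whole
    -- component.
    have haux : ∀ (x : G) (w : G ⧸ C), x ∉ C → orderOf w = k → (x : G ⧸ C) ∈ zpowers w →
        zpowers w = (elemCyclicizer x).image (QuotientGroup.mk' C) := by
      intro x w hx hw hxw
      obtain ⟨y, rfl⟩ := QuotientGroup.mk_surjective w
      have hy : y ∉ C := fun h => by
        rw [(QuotientGroup.eq_one_iff y).mpr h, orderOf_one] at hw
        omega
      obtain ⟨z, hz, hyz, hyeq, hCz⟩ := hmax hy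
      have hxz : x ∈ zpowers z := hmem hxw hCz hyz
      have hxy : elemCyclicizer x = zpowers z := by
        obtain ⟨z', hz', hxz', hxeq, -⟩ := hmax hx
        have h1 : z ∈ elemCyclicizer x := mem_elemCyclicizer_iff.mpr ⟨z, hxz, mem_zpowers z⟩
        rw [hxeq] at h1 ⊢
        rw [zpowers_eq_of_mem_of_orderOf_le h1 (by omega)]
      rw [hxy, zpowers_eq_of_mem_of_orderOf_le (hmap hyz) (by rw [hord z hz hCz, hw]),
        ← coe_map, MonoidHom.map_zpowers]
      rfl
    intro g w w' hg hw hw' hgw hgw'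
    obtain ⟨x, rfl⟩ := QuotientGroup.mk_surjective g
    have hx : x ∉ C := fun h => hg ((QuotientGroup.eq_one_iff x).mpr h)
    exact SetLike.coe_injective ((haux x w hx hw hgw).trans (haux x w' hx hw' hgw').symm)
  refine ⟨k, (isCyclic_or_prime_of_partition hk1 hcov huniq).resolve_left
    (not_isCyclic_quotient_cyclicizerSubgroup hG), fun x => ?_⟩
  obtain ⟨w, hw, hxw⟩ := hcov x
  rw [← QuotientGroup.eq_one_iff, QuotientGroup.mk_pow]
  exact orderOf_dvd_iff_pow_eq_one.mp (hw ▸ orderOf_dvd_of_mem_zpowers hxw)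

/-! ### Splitting off the p'-part and the final classification -/

/-- A group is the direct product of a central subgroup and any complement of it. -/
noncomputable def Subgroup.IsComplement'.prodMulEquiv {G : Type*} [Group G] {H K : Subgroup G}
    (h : IsComplement' H K) (hK : K ≤ center G) : G ≃* H × K :=
  (MulEquiv.ofBijective (MonoidHom.noncommCoprod H.subtype K.subtype fun a b =>
    mem_center_iff.mp (hK b.2) a) h).symm

theorem exists_sylow_mulEquiv_prod_zmod {G : Type*} [Group G] [Finite G] {p : ℕ} [Fact p.Prime]
    {C : Subgroup G} [C.Normal] (hC : C ≤ center G) [IsCyclic C] (hpow : ∀ x : G, x ^ p ∈ C) :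
    ∃ (a m : ℕ) (P : Sylow p G), Nat.card C = p ^ a * m ∧ ¬ p ∣ m ∧
      Nonempty (G ≃* P × Multiplicative (ZMod m)) := by
  have hp : p.Prime := Fact.out
  obtain ⟨a, m, hm, ham⟩ := Nat.exists_eq_pow_mul_and_not_dvd
    (Nat.card_pos (α := C)).ne' p hp.ne_one
  have hpg : IsPGroup p (G ⧸ C) := fun g => by
    obtain ⟨x, rfl⟩ := QuotientGroup.mk_surjective g
    refine ⟨1, ?_⟩
    rw [pow_one, ← QuotientGroup.mk_pow]
    exact (QuotientGroup.eq_one_iff _).mpr (hpow x)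
  obtain ⟨b, hb⟩ := IsPGroup.iff_card.mp hpg
  have hG : Nat.card G = p ^ (a + b) * m := by
    rw [card_eq_card_quotient_mul_card_subgroup C, hb, ham, pow_add]
    ring
  obtain ⟨P⟩ : Nonempty (Sylow p G) := inferInstance
  have hm0 : m ≠ 0 := fun h => hm (h ▸ dvd_zero p)
  have hP : Nat.card P = p ^ (a + b) := by
    rw [P.card_eq_multiplicity, hG, Nat.factorization_mul (pow_ne_zero _ hp.ne_zero) hm0,
      Finsupp.add_apply, hp.factorization_pow, Finsupp.single_eq_same,
      Nat.factorization_eq_zero_of_not_dvd hm, add_zero]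
  obtain ⟨g, hg⟩ := IsCyclic.exists_ofOrder_eq_natCard (α := C)
  -- For a generator g of C, the power g^(p^a) generates the p'-part of C, of order m; coprimality
  -- makes it a complement of P.
  have hO : Nat.card (zpowers ((g : G) ^ p ^ a)) = m := by
    rw [Nat.card_zpowers, orderOf_pow_of_dvd (pow_ne_zero _ hp.ne_zero), orderOf_coe, hg, ham,
      Nat.mul_div_cancel_left _ (pow_pos hp.pos a)]
    rw [orderOf_coe, hg, ham]
    exact dvd_mul_right _ _
  have hcomp : IsComplement' (P : Subgroup G) (zpowers ((g : G) ^ p ^ a)) := by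
    refine isComplement'_of_coprime ?_ ?_
    · rw [hO, hG]
      exact congrArg (· * m) hP
    · rw [hO]
      rw [hP]
      exact Nat.Coprime.pow_left _ ((Nat.Prime.coprime_iff_not_dvd hp).mpr hm)
  refine ⟨a, m, P, ham, hm, ⟨(hcomp.prodMulEquiv ?_).trans (MulEquiv.prodCongr (.refl _) ?_)⟩⟩
  · exact zpowers_le.mpr (hC (pow_mem g.2 _))
  · exact (hO ▸ zmodCyclicMulEquiv inferInstance).symm

theorem exists_mulEquiv_of_ncard_elemCyclicizer_eq {G : Type u} [Group G] [Finite G]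
    (hG : ¬ IsCyclic G) {c : ℕ} (hc : ∀ x ∉ groupCyclicizer G, (elemCyclicizer x).ncard = c) :
    (∃ n : ℕ, Odd n ∧ Nonempty (G ≃* QuaternionGroup 2 × Multiplicative (ZMod n))) ∨
      (∃ (P : Type u) (_ : Group P) (p m : ℕ),
        Finite P ∧ ¬ IsCyclic P ∧ p.Prime ∧ Monoid.exponent P = p ∧
          0 < m ∧ Nat.gcd m p = 1 ∧ Nonempty (G ≃* P × Multiplicative (ZMod m))) := by
  obtain ⟨p, hp, hpow⟩ := exists_prime_forall_pow_mem_cyclicizerSubgroup hG hc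
  have : Fact p.Prime := ⟨hp⟩
  set C := cyclicizerSubgroup G
  have hCc : C ≤ center G := cyclicizerSubgroup_le_center G
  have hCcyc : IsCyclic C := by
    obtain ⟨z, -, hz⟩ := exists_zpowers_of_cyclicizerSubgroup (1 : G)
    exact isCyclic_of_le hz
  obtain ⟨a, m, P, ham, hm, ⟨e⟩⟩ := exists_sylow_mulEquiv_prod_zmod hCc hpow
  have hm0 : 0 < m := Nat.pos_of_ne_zero fun h => hm (h ▸ dvd_zero p)
  have hmp : p.Coprime m := (Nat.Prime.coprime_iff_not_dvd hp).mpr hm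
  have hPcyc : ¬ IsCyclic P := fun h => by
    refine hG (e.isCyclic.mpr (Group.isCyclic_prod_iff.mpr ⟨h, inferInstance, ?_⟩))
    rw [P.card_eq_multiplicity, show Nat.card (Multiplicative (ZMod m)) = m from Nat.card_zmod m]
    exact hmp.pow_left _
  obtain ⟨g, hg⟩ := (Subgroup.isCyclic_iff_exists_zpowers_eq_top C).mp hCcyc
  have hgC : orderOf g = Nat.card C := by rw [← Nat.card_zpowers, hg]
  have hord : ∀ x : P, ∃ i, orderOf (x : G) = p ^ i := fun x => by
    rw [orderOf_coe]
    exact IsPGroup.iff_orderOf.mp P.isPGroup' x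
  -- Any x shares a cyclic subgroup with C, so C consists of exactly the elements whose order
  -- divides |C|.
  have hndvd : ∀ x : G, orderOf x ∣ Nat.card C → x ∈ C := fun x hx => by
    obtain ⟨z, hxz, hz⟩ := exists_zpowers_of_cyclicizerSubgroup x
    rw [← hg]
    exact mem_zpowers_of_orderOf_dvd hxz (hz (hg.le (mem_zpowers g))) (hgC ▸ hx)
  have hCdvd : ∀ x ∈ C, orderOf x ∣ Nat.card C := fun x hx => by
    rw [← orderOf_mk x hx]
    exact orderOf_dvd_natCard _
  rcases Nat.eq_zero_or_pos a with rfl | ha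
  · right
    rw [pow_zero, one_mul] at ham
    refine ⟨P, inferInstance, p, m, inferInstance, hPcyc, hp, ?_, hm0, hmp.symm, ⟨e⟩⟩
    have hdvd : Monoid.exponent P ∣ p := Monoid.exponent_dvd_of_forall_pow_eq_one fun x => by
      refine Subtype.ext ?_
      obtain ⟨i, hi⟩ := hord (x ^ p)
      have h1 := hCdvd _ (hpow x)
      rw [← SubmonoidClass.coe_pow, hi, ham] at h1
      have h2 : p ^ i = 1 := Nat.Coprime.eq_one_of_dvd (hmp.pow_left i) h1
      exact orderOf_eq_one_iff.mp (hi.trans h2)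
    refine ((Nat.dvd_prime hp).mp hdvd).resolve_left fun h => hPcyc ?_
    have := Monoid.exp_eq_one_iff.mp h
    infer_instance
  · left
    have hpC : p ∣ Nat.card C := ham ▸ (dvd_pow_self p ha.ne').mul_right m
    have hne : (C.subgroupOf (P : Subgroup G)) ≠ ⊤ := fun h => by
      exact hPcyc (isCyclic_of_le (H' := C) (subgroupOf_eq_top.mp h))
    have key := quaternion_of_central_subgroup_eq_zpowers_pow (D := C.subgroupOf (P : Subgroup G))
      hp P.isPGroup' ?_ ?_ hne hPcyc ?_ ?_
    · obtain ⟨rfl, ⟨f⟩⟩ := key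
      exact ⟨m, Nat.coprime_two_left.mp hmp, ⟨e.trans (MulEquiv.prodCongr f (.refl _))⟩⟩
    · exact fun x hx => mem_center_iff.mpr fun y => Subtype.ext (mem_center_iff.mp (hCc hx) y)
    · intro hbot
      obtain ⟨x, hx⟩ : ∃ x, x ∉ C.subgroupOf (P : Subgroup G) := by
        by_contra! h
        exact hne ((eq_top_iff' _).mpr h)
      have h1 : x ^ p ∈ C.subgroupOf (P : Subgroup G) := hpow x
      rw [hbot, mem_bot] at h1
      refine hx (hndvd x ?_)
      rw [orderOf_coe]
      exact (orderOf_dvd_of_pow_eq_one h1).trans hpC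
    · exact fun x _ => hpow x
    · intro x hx d hd
      obtain ⟨z, hxz, hz⟩ := exists_zpowers_of_cyclicizerSubgroup (x : G)
      -- Here |d| = p^j divides |C| but |x| = p^i does not, so j < i and p^j divides p^(i-1) =
      -- |x^p|.
      have hdvd : orderOf (d : G) ∣ orderOf ((x : G) ^ p) := by
        obtain ⟨i, hi⟩ := hord x
        obtain ⟨j, hj⟩ := hord d
        have hlt : j < i := by
          by_contra! h
          exact hx (hndvd x (((hi ▸ hj ▸ pow_dvd_pow p h :
            orderOf (x : G) ∣ orderOf (d : G))).trans (hCdvd _ hd)))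
        obtain ⟨l, rfl⟩ : ∃ l, i = l + 1 := ⟨i - 1, by omega⟩
        rw [orderOf_pow_of_dvd hp.ne_zero (hi ▸ dvd_pow_self p (by omega)), hi, hj, pow_succ,
          Nat.mul_div_cancel _ hp.pos]
        exact pow_dvd_pow p (by omega)
      obtain ⟨n, hn⟩ := mem_zpowers_iff.mp
        (mem_zpowers_of_orderOf_dvd (hz hd) (pow_mem hxz p) hdvd)
      exact mem_zpowers_iff.mpr ⟨n, Subtype.ext hn⟩

theorem theorem5p1 (G : Type u) [Group G] [Finite G] (hG : ¬ IsCyclic G) :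
    (∃ d : ℕ, (nonCyclicGraph G).IsRegularOfDegree d) ↔
      ((∃ n : ℕ, Odd n ∧ Nonempty (G ≃* QuaternionGroup 2 × Multiplicative (ZMod n))) ∨
        (∃ (P : Type u) (_ : Group P) (p m : ℕ),
          Finite P ∧ ¬ IsCyclic P ∧ p.Prime ∧ Monoid.exponent P = p ∧
            0 < m ∧ Nat.gcd m p = 1 ∧ Nonempty (G ≃* P × Multiplicative (ZMod m)))) := by
  rw [nonCyclicGraph_isRegular_iff]
  constructor
  · rintro ⟨c, hc⟩
    exact exists_mulEquiv_of_ncard_elemCyclicizer_eq hG hc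
  · rintro (⟨n, hn, ⟨e⟩⟩ | ⟨P, _, p, m, _, -, hp, hexp, -, hm, ⟨e⟩⟩)
    · exact ⟨4 * n, fun x hx => ncard_elemCyclicizer_of_mulEquiv_quaternion_prod hn e hx⟩
    · exact ⟨p * m, fun x hx => ncard_elemCyclicizer_of_mulEquiv_exponent_prod hp hexp hm e hx⟩
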